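/- Let $G$ be a finite graph and $M \subseteq V(G)$. Two vertices $u,v \in M$ are $M$-visible if there is a shortest $u,v$-path in $G$ that contains no vertex of $M \setminus \{u,v\}$; $M$ is a mutual-visibility set of $G$ if its vertices are pairwise $M$-visible, and the mutual-visibility number $\mu(G)$ is the size of a largest mutual-visibility set of $G$. Let $P_s$ be the path on $s$ vertices, $C_t$ the cycle on $t$ vertices, and $\Box$ the Cartesian product of graphs. If $s$ and $t$ are integers with $s + 1 \ge t \ge 6$, then $\mu(P_s \Box C_t) = 2t$. -/

import Mathlib

open scoped SimpleGraph

namespace SimpleGraph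

variable {V : Type*}

/-- Two vertices `u`, `v` are `M`-visible in `G` if there is a shortest `u,v`-path of `G` that
contains no vertex of `M` other than (possibly) `u` and `v`. -/
def Visible (G : SimpleGraph V) (M : Set V) (u v : V) : Prop :=
  ∃ p : G.Walk u v, p.IsPath ∧ p.length = G.dist u v ∧
    ∀ w ∈ p.support, w ∉ M \ {u, v}

/-- `M` is a mutual-visibility set of `G` if its vertices are pairwise `M`-visible. -/
def IsMutualVisibilitySet (G : SimpleGraph V) (M : Set V) : Prop :=
  ∀ u ∈ M, ∀ v ∈ M, G.Visible M u v

/-- The mutual-visibility number of a finite graph `G`: the size of a largest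
mutual-visibility set of `G`. -/
noncomputable def mutualVisibilityNumber [Finite V] (G : SimpleGraph V) : ℕ :=
  sSup {n : ℕ | ∃ M : Set V, G.IsMutualVisibilitySet M ∧ M.ncard = n}

/-- On a finite graph the supremum in the definition is an attained maximum. -/
theorem isGreatest_mutualVisibilityNumber [Finite V] (G : SimpleGraph V) :
    IsGreatest {n : ℕ | ∃ M : Set V, G.IsMutualVisibilitySet M ∧ M.ncard = n}
      G.mutualVisibilityNumber := by
  have hb : BddAbove {n : ℕ | ∃ M : Set V, G.IsMutualVisibilitySet M ∧ M.ncard = n} := by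
    refine ⟨Nat.card V, ?_⟩
    rintro n ⟨M, -, rfl⟩
    exact Set.ncard_le_card M
  have hne : {n : ℕ | ∃ M : Set V, G.IsMutualVisibilitySet M ∧ M.ncard = n}.Nonempty :=
    ⟨0, ∅, fun u hu => absurd hu (Set.notMem_empty u), Set.ncard_empty V⟩
  exact ⟨Nat.sSup_mem hne hb, fun n hn => le_csSup hb hn⟩

end SimpleGraph

-- Call the copies of the path columns. Upper bound: a shortest path between two vertices of one
-- column has no length to spare for horizontal steps, so it is the vertical segment, and a third
-- member between them would block it. Hence each column holds at most two members
-- (`IsMutualVisibilitySet.not_three_in_column`), giving `2 * t`. Lower bound: exhibit a set with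
-- exactly two members in every column. Work in the universal cover, a strip over `ℤ`: a monotone
-- lattice path whose horizontal extent is at most `t / 2` projects to a geodesic
-- (`le_length_of_lift`), so visibility becomes a search for an unblocked monotone path with few
-- turns (`visible_of_five_segments`). For `t ≥ 7`, with `n = ⌊t / 2⌋`, the members form a lower and
-- an upper tent within heights `0, …, t - 2`, which is where `t ≤ s + 1` enters. The tents nearly
-- touch beside column `0` and are far apart opposite it; column `0` itself has members only at
-- heights `0` and `t - 2`. This leaves four kinds of routes: under the lower tent, over the upper
-- one, between the two, and through the open interior of column `0`. For `t = 6` a different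
-- explicit set is checked by computation.

namespace SimpleGraph

-- Walks avoiding a set, and visibility.

section Clear

variable {V : Type*} {G : SimpleGraph V}

/-- There is a walk of length `n` from `u` to `v` that avoids the set `F`. -/
def ClearWalk (G : SimpleGraph V) (F : Set V) (u v : V) (n : ℕ) : Prop :=
  ∃ p : G.Walk u v, p.length = n ∧ ∀ w ∈ p.support, w ∉ F

theorem ClearWalk.refl {F : Set V} {u : V} (hu : u ∉ F) : G.ClearWalk F u u 0 :=
  ⟨Walk.nil, rfl, by simpa using hu⟩

theorem ClearWalk.trans {F : Set V} {u v w : V} {m n : ℕ} (h₁ : G.ClearWalk F u v m)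
    (h₂ : G.ClearWalk F v w n) : G.ClearWalk F u w (m + n) := by
  obtain ⟨p, rfl, hp⟩ := h₁
  obtain ⟨q, rfl, hq⟩ := h₂
  refine ⟨p.append q, Walk.length_append p q, fun x hx => ?_⟩
  rcases (Walk.mem_support_append_iff p q).1 hx with h | h
  exacts [hp x h, hq x h]

theorem ClearWalk.symm {F : Set V} {u v : V} {n : ℕ} (h : G.ClearWalk F u v n) :
    G.ClearWalk F v u n := by
  obtain ⟨p, rfl, hp⟩ := h
  exact ⟨p.reverse, p.length_reverse, fun x hx => hp x (by simpa using hx)⟩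

theorem ClearWalk.of_adj {F : Set V} {u v : V} (h : G.Adj u v) (hu : u ∉ F) (hv : v ∉ F) :
    G.ClearWalk F u v 1 :=
  ⟨h.toWalk, rfl, fun x hx => by
    have : x = u ∨ x = v := by simpa using hx
    rcases this with rfl | rfl <;> assumption⟩

/-- A walk no longer than any other is a geodesic and hence automatically a path, so concatenated
walks need only a length count. -/
theorem ClearWalk.visible {M : Set V} {u v : V} {n : ℕ} (h : G.ClearWalk (M \ {u, v}) u v n)
    (hn : ∀ p : G.Walk u v, n ≤ p.length) : G.Visible M u v := by
  obtain ⟨p, rfl, hp⟩ := h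
  have hd : p.length = G.dist u v := by
    obtain ⟨q, hq⟩ := (p.reachable).exists_walk_length_eq_dist
    exact le_antisymm (hq ▸ hn q) (dist_le p)
  exact ⟨p, p.isPath_of_length_eq_dist hd, hd, hp⟩

theorem Visible.symm {M : Set V} {u v : V} (h : G.Visible M u v) : G.Visible M v u := by
  obtain ⟨p, hp, hl, hs⟩ := h
  refine ⟨p.reverse, hp.reverse, by rw [p.length_reverse, hl, dist_comm], fun w hw => ?_⟩
  rw [Set.pair_comm]
  exact hs w (by simpa using hw)

end Clear

-- Lengths of walks in the cylinder and the upper bound.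

section Cylinder

variable {s t : ℕ}

/-- The Cartesian product of a path and a cycle. -/
abbrev cylinder (s t : ℕ) : SimpleGraph (Fin s × Fin t) :=
  SimpleGraph.boxProd (SimpleGraph.pathGraph s) (SimpleGraph.cycleGraph t)

theorem cycleGraph_adj_emod {u v : Fin t} (ht : 2 ≤ t) :
    (cycleGraph t).Adj u v ↔
      ((v : ℤ) - u - 1) % t = 0 ∨ ((v : ℤ) - u + 1) % t = 0 := by
  have hu := u.isLt
  have hv := v.isLt
  rw [cycleGraph_adj', Fin.val_sub, Fin.val_sub]
  have key : ∀ a b : ℕ, a < t → b < t →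
      ((t - b + a) % t = 1 ↔ ((b : ℤ) - a + 1) % t = 0) := by
    intro a b ha hb
    constructor
    · intro h
      have h2 := Nat.div_add_mod (t - b + a) t
      rw [h] at h2
      apply Int.emod_eq_zero_of_dvd
      refine ⟨1 - ((t - b + a) / t : ℕ), ?_⟩
      have h3 : (t : ℤ) * ((t - b + a) / t : ℕ) + 1 = (t : ℤ) - b + a := by
        have : ((t - b + a : ℕ) : ℤ) = (t : ℤ) - b + a := by omega
        rw [← this]
        exact_mod_cast h2
      linarith
    · intro h
      -- Since `b - a + 1` lies in `(-t, t]`, the quotient `q` can only be `0` or `1`.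
      obtain ⟨q, hq⟩ := Int.dvd_of_emod_eq_zero h
      have hq1 : q < 2 := by
        by_contra hc
        have : (t : ℤ) * 2 ≤ t * q := by gcongr; omega
        omega
      have hq2 : -1 < q := by
        by_contra hc
        have : (t : ℤ) * q ≤ t * (-1) := by gcongr; omega
        omega
      have : q = 0 ∨ q = 1 := by omega
      rcases this with rfl | rfl
      · rw [show t - b + a = 1 + t by omega, Nat.add_mod_right, Nat.mod_eq_of_lt (by omega)]
      · rw [show t - b + a = 1 by omega, Nat.mod_eq_of_lt (by omega)]
  rw [key _ _ hu hv, key _ _ hv hu, ← Int.dvd_iff_emod_eq_zero, ← Int.dvd_iff_emod_eq_zero,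
    ← Int.dvd_iff_emod_eq_zero, ← dvd_neg (b := (v : ℤ) - u - 1), or_comm]
  rw [show -((v : ℤ) - u - 1) = u - v + 1 by ring]

/-- Along a walk of the cylinder, the horizontal displacement `k` of a lift to the universal cover
and the vertical displacement together are at most the length. -/
theorem exists_lift_le_length (ht : 2 ≤ t) {u v : Fin s × Fin t} (p : (cylinder s t).Walk u v) :
    ∃ k : ℤ, ((v.2 : ℤ) - u.2 - k) % t = 0 ∧ |(v.1 : ℤ) - u.1| + |k| ≤ p.length := by
  induction p with
  | nil => exact ⟨0, by simp⟩
  | @cons u v w h p ih =>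
    obtain ⟨k, hk, hl⟩ := ih
    rw [Walk.length_cons]
    push_cast
    rcases boxProd_adj.1 h with ⟨h1, h2⟩ | ⟨h1, h2⟩
    · refine ⟨k, h2 ▸ hk, ?_⟩
      rw [pathGraph_adj] at h1
      have h3 := abs_sub_le (w.1 : ℤ) v.1 u.1
      have h4 : |(v.1 : ℤ) - u.1| ≤ 1 := abs_le.2 (by omega)
      linarith
    · rw [cycleGraph_adj_emod ht] at h1
      rw [← h2] at hl
      simp only [← Int.dvd_iff_emod_eq_zero] at h1 hk ⊢
      rcases h1 with h1 | h1
      · refine ⟨k + 1, ?_, ?_⟩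
        · rw [show (w.2 : ℤ) - u.2 - (k + 1) = w.2 - v.2 - k + (v.2 - u.2 - 1) by ring]
          exact dvd_add hk h1
        · have : |k + 1| ≤ |k| + 1 := (abs_add_le k 1).trans (by simp)
          linarith
      · refine ⟨k - 1, ?_, ?_⟩
        · rw [show (w.2 : ℤ) - u.2 - (k - 1) = w.2 - v.2 - k + (v.2 - u.2 + 1) by ring]
          exact dvd_add hk h1
        · have : |k - 1| ≤ |k| + 1 := (abs_sub k 1).trans (by simp)
          linarith

/-- Discrete intermediate value principle: an edge changes the height by at most one. -/
theorem exists_mem_support_fst_eq {u v : Fin s × Fin t}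
    (p : (cylinder s t).Walk u v) (y : Fin s) (hu : u.1 ≤ y) (hv : y ≤ v.1) :
    ∃ w ∈ p.support, w.1 = y := by
  induction p with
  | @nil u => exact ⟨u, by simp, le_antisymm hu hv⟩
  | @cons u v w h p ih =>
    by_cases hy : u.1 = y
    · exact ⟨u, by simp, hy⟩
    · obtain ⟨x, hx, rfl⟩ := ih (by
        rcases boxProd_adj.1 h with ⟨h1, h2⟩ | ⟨h1, h2⟩
        · rw [pathGraph_adj] at h1
          omega
        · omega) hv
      exact ⟨x, by simp [hx], rfl⟩

/-- A geodesic from `(a, x)` to `(c, x)` meets height `b`. Its length `c - a` is used up by vertical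
steps, so the lift has not moved sideways by then and the vertex met is `(b, x)`. -/
theorem IsMutualVisibilitySet.not_three_in_column (ht : 2 ≤ t) {M : Set (Fin s × Fin t)}
    (hM : (cylinder s t).IsMutualVisibilitySet M) {a b c : Fin s} {x : Fin t}
    (ha : (a, x) ∈ M) (hb : (b, x) ∈ M) (hc : (c, x) ∈ M) (hab : a < b) (hbc : b < c) : False := by
  obtain ⟨p, -, hl, hs⟩ := hM _ ha _ hc
  obtain ⟨w, hw, rfl⟩ := exists_mem_support_fst_eq p b hab.le hbc.le
  have hlen : p.length ≤ (c : ℤ) - a := by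
    rw [hl]
    -- The explicit vertical walk bounds the distance from above.
    have : ∀ (n : ℕ) (c : Fin s), (c : ℕ) = a + n →
        ∃ q : (cylinder s t).Walk (a, x) (c, x), q.length = n := by
      intro n
      induction n with
      | zero =>
        intro c hc
        obtain rfl : c = a := Fin.ext (by simpa using hc)
        exact ⟨Walk.nil, rfl⟩
      | succ n ih =>
        intro c hc
        obtain ⟨q, hq⟩ := ih ⟨a + n, by omega⟩ rfl
        refine ⟨q.concat (boxProd_adj.2 (Or.inl ⟨?_, rfl⟩)), by simp [hq]⟩
        rw [pathGraph_adj]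
        left
        simp only
        omega
    obtain ⟨q, hq⟩ := this (c - a) c (by omega)
    have := dist_le q
    omega
  have hsplit := congrArg Walk.length (p.take_spec hw)
  rw [Walk.length_append] at hsplit
  obtain ⟨k, hk, h1⟩ := exists_lift_le_length ht (p.takeUntil w hw)
  obtain ⟨k', -, h2⟩ := exists_lift_le_length ht (p.dropUntil w hw)
  simp only at h1 h2 hk
  have hk0 : k = 0 := by
    have h3 := abs_nonneg k'
    have h4 : |k| ≤ 0 := by
      rw [abs_of_pos (by omega : (0 : ℤ) < (w.1 : ℤ) - a)] at h1
      rw [abs_of_pos (by omega : (0 : ℤ) < (c : ℤ) - w.1)] at h2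
      omega
    exact abs_eq_zero.1 (le_antisymm h4 (abs_nonneg k))
  have hx : w.2 = x := by
    subst hk0
    obtain ⟨q, hq⟩ := Int.dvd_of_emod_eq_zero hk
    have := w.2.isLt
    have := x.isLt
    have hq1 : q < 1 := by
      by_contra hc
      have : (t : ℤ) * 1 ≤ t * q := by gcongr; omega
      omega
    have hq2 : -1 < q := by
      by_contra hc
      have : (t : ℤ) * q ≤ t * (-1) := by gcongr; omega
      omega
    obtain rfl : q = 0 := by omega
    apply Fin.ext
    omega
  refine hs w hw ⟨by rw [← hx] at hb; exact hb, ?_⟩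
  rintro (h | h)
  · rw [h] at hab; exact lt_irrefl _ hab
  · rw [Set.mem_singleton_iff.1 h] at hbc; exact lt_irrefl _ hbc

theorem IsMutualVisibilitySet.ncard_le_cylinder (ht : 2 ≤ t) {M : Set (Fin s × Fin t)}
    (hM : (cylinder s t).IsMutualVisibilitySet M) : M.ncard ≤ 2 * t := by
  classical
  rw [Set.ncard_eq_toFinset_card' M]
  have := Finset.card_le_mul_card_image_of_maps_to (s := M.toFinset) (f := Prod.snd)
    (t := Finset.univ) (fun _ _ => Finset.mem_univ _) 2 (fun x _ => by
      by_contra! hcard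
      obtain ⟨a, ha, b, hb, c, hc, hab, hac, hbc⟩ := Finset.two_lt_card.1 hcard
      clear hcard
      obtain ⟨a, a'⟩ := a
      obtain ⟨b, b'⟩ := b
      obtain ⟨c, c'⟩ := c
      simp only [Finset.mem_filter, Set.mem_toFinset] at ha hb hc
      obtain ⟨ha, rfl⟩ := ha
      obtain ⟨hb, rfl : b' = a'⟩ := hb
      obtain ⟨hc, rfl : c' = b'⟩ := hc
      have hab : a ≠ b := fun h => hab (by rw [h])
      have hac : a ≠ c := fun h => hac (by rw [h])
      have hbc : b ≠ c := fun h => hbc (by rw [h])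
      rcases lt_or_gt_of_ne hab with h1 | h1 <;> rcases lt_or_gt_of_ne hac with h2 | h2 <;>
        rcases lt_or_gt_of_ne hbc with h3 | h3
      · exact hM.not_three_in_column ht ha hb hc h1 h3
      · exact hM.not_three_in_column ht ha hc hb h2 h3
      · exact absurd (h1.trans h3) h2.asymm
      · exact hM.not_three_in_column ht hc ha hb h2 h1
      · exact hM.not_three_in_column ht hb ha hc h1 h2
      · exact absurd (h3.trans h1) h2.asymm
      · exact hM.not_three_in_column ht hb hc ha h3 h2
      · exact hM.not_three_in_column ht hc hb ha h3 h1)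
  simpa using this

end Cylinder

-- Monotone lattice paths in the universal cover.

section Lift

variable {s t : ℕ} [NeZero s] [NeZero t]

/-- The vertex of the cylinder at height `y` below the point `z` of the universal cover. -/
def cylinderPoint (s t : ℕ) [NeZero s] [NeZero t] (y z : ℤ) : Fin s × Fin t :=
  (Fin.ofNat s y.toNat, Fin.ofNat t (z % t).toNat)

theorem cylinderPoint_fst {y : ℤ} (z : ℤ) (h0 : 0 ≤ y) (hs : y < s) :
    ((cylinderPoint s t y z).1 : ℤ) = y := by
  simp only [cylinderPoint, Fin.val_ofNat]
  rw [Nat.mod_eq_of_lt (by omega)]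
  omega

theorem cylinderPoint_snd (y z : ℤ) : ((cylinderPoint s t y z).2 : ℤ) = z % t := by
  have ht : (0 : ℤ) < t := by exact_mod_cast Nat.pos_of_neZero t
  have h0 := Int.emod_nonneg z ht.ne'
  have h1 := Int.emod_lt_of_pos z ht
  simp only [cylinderPoint, Fin.val_ofNat]
  rw [Nat.mod_eq_of_lt (by omega)]
  omega

theorem cylinderPoint_add (y z : ℤ) :
    cylinderPoint s t y (z + t) = cylinderPoint s t y z := by
  simp [cylinderPoint]

theorem cylinderPoint_coe (u : Fin s × Fin t) : cylinderPoint s t u.1 u.2 = u := by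
  have h1 : ((u.2 : ℤ) % t).toNat = u.2 := by
    rw [Int.emod_eq_of_lt (by omega) (by exact_mod_cast u.2.isLt)]
    simp
  ext <;> simp only [cylinderPoint, h1, Int.toNat_natCast, Fin.val_ofNat]
  · exact Nat.mod_eq_of_lt u.1.isLt
  · exact Nat.mod_eq_of_lt u.2.isLt

theorem adj_cylinderPoint_horizontal (ht : 2 ≤ t) (y z : ℤ) :
    (cylinder s t).Adj (cylinderPoint s t y z) (cylinderPoint s t y (z + 1)) := by
  refine boxProd_adj.2 (Or.inr ⟨(cycleGraph_adj_emod ht).2 (Or.inl ?_), rfl⟩)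
  rw [cylinderPoint_snd, cylinderPoint_snd, ← Int.dvd_iff_emod_eq_zero]
  have h1 := Int.dvd_self_sub_emod (x := z) (m := t)
  have h2 := Int.dvd_self_sub_emod (x := z + 1) (m := t)
  have := dvd_sub h1 h2
  rwa [show z - z % t - (z + 1 - (z + 1) % t) = (z + 1) % t - z % t - 1 by ring] at this

theorem adj_cylinderPoint_vertical {y : ℤ} (z : ℤ) (h0 : 0 ≤ y) (hs : y + 1 < s) :
    (cylinder s t).Adj (cylinderPoint s t y z) (cylinderPoint s t (y + 1) z) := by
  refine boxProd_adj.2 (Or.inl ⟨?_, rfl⟩)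
  rw [pathGraph_adj]
  have h1 := cylinderPoint_fst (s := s) (t := t) z h0 (by omega)
  have h2 := cylinderPoint_fst (s := s) (t := t) z (by omega : 0 ≤ y + 1) hs
  omega

theorem clearWalk_horizontal (ht : 2 ≤ t) {F : Set (Fin s × Fin t)} {y x x' : ℤ} (hx : x ≤ x')
    (h : ∀ z, x ≤ z → z ≤ x' → cylinderPoint s t y z ∉ F) :
    (cylinder s t).ClearWalk F (cylinderPoint s t y x) (cylinderPoint s t y x')
      (x' - x).toNat := by
  obtain ⟨n, rfl⟩ := Int.le.dest hx
  rw [show (x + n - x).toNat = n by omega]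
  clear hx
  induction n with
  | zero => simpa using ClearWalk.refl (h x le_rfl (by simp))
  | succ n ih =>
    refine (ih fun z h1 h2 => h z h1 (by omega)).trans ?_
    push_cast
    rw [← add_assoc]
    exact ClearWalk.of_adj (adj_cylinderPoint_horizontal ht _ _) (h _ (by omega) (by omega))
      (h _ (by omega) (by omega))

theorem clearWalk_up {F : Set (Fin s × Fin t)} {y y' : ℤ} (z : ℤ) (hy : y ≤ y') (h0 : 0 ≤ y)
    (hs : y' < s) (h : ∀ w, y ≤ w → w ≤ y' → cylinderPoint s t w z ∉ F) :
    (cylinder s t).ClearWalk F (cylinderPoint s t y z) (cylinderPoint s t y' z)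
      (y' - y).toNat := by
  obtain ⟨n, rfl⟩ := Int.le.dest hy
  rw [show (y + n - y).toNat = n by omega]
  clear hy
  induction n with
  | zero => simpa using ClearWalk.refl (h y le_rfl (by simp))
  | succ n ih =>
    refine (ih (by omega) fun z h1 h2 => h z h1 (by omega)).trans ?_
    push_cast
    rw [← add_assoc]
    exact ClearWalk.of_adj (adj_cylinderPoint_vertical _ (by omega) (by omega))
      (h _ (by omega) (by omega)) (h _ (by omega) (by omega))

theorem clearWalk_vertical {F : Set (Fin s × Fin t)} {y y' : ℤ} (z : ℤ) (h0 : 0 ≤ y) (hs : y < s)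
    (h0' : 0 ≤ y') (hs' : y' < s)
    (h : ∀ w, (y ≤ w ∧ w ≤ y') ∨ (y' ≤ w ∧ w ≤ y) → cylinderPoint s t w z ∉ F) :
    (cylinder s t).ClearWalk F (cylinderPoint s t y z) (cylinderPoint s t y' z)
      (y' - y).natAbs := by
  rcases le_total y y' with hy | hy
  · rw [show (y' - y).natAbs = (y' - y).toNat by omega]
    exact clearWalk_up z hy h0 hs' fun w h1 h2 => h w (Or.inl ⟨h1, h2⟩)
  · rw [show (y' - y).natAbs = (y - y').toNat by omega]
    exact (clearWalk_up z hy h0' hs fun w h1 h2 => h w (Or.inr ⟨h1, h2⟩)).symm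

/-- Among the integers congruent to `j - i` modulo `t`, none has smaller absolute value than `j - i`
itself, because `2 * (j - i) ≤ t`. -/
theorem le_length_of_lift (ht : 2 ≤ t) {i j yi yj : ℤ} (hij : i ≤ j) (hd : 2 * (j - i) ≤ t)
    (hi0 : 0 ≤ yi) (his : yi < s) (hj0 : 0 ≤ yj) (hjs : yj < s)
    (p : (cylinder s t).Walk (cylinderPoint s t yi i) (cylinderPoint s t yj j)) :
    (yj - yi).natAbs + (j - i).toNat ≤ p.length := by
  obtain ⟨k, hk, hl⟩ := exists_lift_le_length ht p
  rw [cylinderPoint_fst _ hi0 his, cylinderPoint_fst _ hj0 hjs] at hl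
  rw [cylinderPoint_snd, cylinderPoint_snd, ← Int.dvd_iff_emod_eq_zero] at hk
  have h1 := Int.dvd_self_sub_emod (x := i) (m := t)
  have h2 := Int.dvd_self_sub_emod (x := j) (m := t)
  have h3 := dvd_sub (dvd_add h2 hk) h1
  rw [show j - j % t + (j % t - i % t - k) - (i - i % t) = j - i - k by ring] at h3
  obtain ⟨q, hq⟩ := h3
  have hk' : j - i ≤ |k| := by
    rcases lt_trichotomy q 0 with h | rfl | h
    · have : (t : ℤ) * q ≤ t * (-1) := by gcongr; omega
      exact le_trans (by omega) (le_abs_self k)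
    · exact le_trans (by omega) (le_abs_self k)
    · have : (t : ℤ) * 1 ≤ t * q := by gcongr; omega
      exact le_trans (by omega) (neg_le_abs k)
  rw [← Int.natCast_natAbs] at hl
  omega

/-- Visibility along a monotone path with at most five segments: vertically to height `m₁`,
horizontally to column `k`, vertically to height `m₂`, horizontally to column `j`, and vertically to
the target. The members of `M` that matter are described by the relation `H`. -/
theorem visible_of_five_segments (ht : 2 ≤ t) {M : Set (Fin s × Fin t)}
    {H : ℤ → ℤ → Prop}
    (hH : ∀ y z : ℤ, 0 ≤ y → y < s → -(t : ℤ) < z → z < t → cylinderPoint s t y z ∈ M → H y z)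
    {i j yi yj : ℤ}
    (m₁ k m₂ : ℤ) (hik : i ≤ k) (hkj : k ≤ j) (hd : 2 * (j - i) ≤ t)
    (hit : -(t : ℤ) < i) (hjt : j < t)
    (hi0 : 0 ≤ yi) (his : yi < s) (hj0 : 0 ≤ yj) (hjs : yj < s)
    (hm : (yi ≤ m₁ ∧ m₁ ≤ m₂ ∧ m₂ ≤ yj) ∨ (yj ≤ m₂ ∧ m₂ ≤ m₁ ∧ m₁ ≤ yi))
    (h : ∀ y z, (z = i ∧ (yi ≤ y ∧ y ≤ m₁ ∨ m₁ ≤ y ∧ y ≤ yi)) ∨ (y = m₁ ∧ i ≤ z ∧ z ≤ k) ∨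
      (z = k ∧ (m₁ ≤ y ∧ y ≤ m₂ ∨ m₂ ≤ y ∧ y ≤ m₁)) ∨ (y = m₂ ∧ k ≤ z ∧ z ≤ j) ∨
      (z = j ∧ (m₂ ≤ y ∧ y ≤ yj ∨ yj ≤ y ∧ y ≤ m₂)) → H y z →
      (y = yi ∧ z = i) ∨ (y = yj ∧ z = j)) :
    (cylinder s t).Visible M (cylinderPoint s t yi i) (cylinderPoint s t yj j) := by
  replace h := fun y z hz hmem => h y z hz
    (hH y z (by omega) (by omega) (by omega) (by omega) hmem)
  have hF : ∀ y z, ((y = yi ∧ z = i) ∨ (y = yj ∧ z = j)) →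
      cylinderPoint s t y z ∈ ({cylinderPoint s t yi i, cylinderPoint s t yj j} : Set _) := by
    rintro y z (⟨rfl, rfl⟩ | ⟨rfl, rfl⟩) <;> simp
  refine ClearWalk.visible (n := (yj - yi).natAbs + (j - i).toNat) ?_
    (le_length_of_lift ht (hik.trans hkj) hd hi0 his hj0 hjs)
  -- Monotonicity, from `hm`, `hik` and `hkj`, makes the five segment lengths add up to the lower
  -- bound for all walks.
  rw [show (yj - yi).natAbs + (j - i).toNat = (m₁ - yi).natAbs + (k - i).toNat +
    (m₂ - m₁).natAbs + (j - k).toNat + (yj - m₂).natAbs by omega]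
  refine ((((clearWalk_vertical i (by omega) (by omega) (by omega) (by omega) ?_).trans
    (clearWalk_horizontal ht hik ?_)).trans
    (clearWalk_vertical k (by omega) (by omega) (by omega) (by omega) ?_)).trans
    (clearWalk_horizontal ht hkj ?_)).trans
    (clearWalk_vertical j (by omega) (by omega) (by omega) (by omega) ?_)
  · exact fun y hy hmem => hmem.2 (hF _ _ (h y i (Or.inl ⟨rfl, hy⟩) hmem.1))
  · exact fun z h1 h2 hmem => hmem.2 (hF _ _ (h m₁ z (Or.inr (Or.inl ⟨rfl, h1, h2⟩)) hmem.1))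
  · exact fun y hy hmem =>
      hmem.2 (hF _ _ (h y k (Or.inr (Or.inr (Or.inl ⟨rfl, hy⟩))) hmem.1))
  · exact fun z h1 h2 hmem =>
      hmem.2 (hF _ _ (h m₂ z (Or.inr (Or.inr (Or.inr (Or.inl ⟨rfl, h1, h2⟩)))) hmem.1))
  · exact fun y hy hmem =>
      hmem.2 (hF _ _ (h y j (Or.inr (Or.inr (Or.inr (Or.inr ⟨rfl, hy⟩)))) hmem.1))

/-- Visibility along a vertical-horizontal-vertical path. -/
theorem visible_of_row (ht : 2 ≤ t) {M : Set (Fin s × Fin t)}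
    {H : ℤ → ℤ → Prop}
    (hH : ∀ y z : ℤ, 0 ≤ y → y < s → -(t : ℤ) < z → z < t → cylinderPoint s t y z ∈ M → H y z)
    {i j yi yj : ℤ}
    (m : ℤ) (hij : i ≤ j) (hd : 2 * (j - i) ≤ t)
    (hit : -(t : ℤ) < i) (hjt : j < t)
    (hi0 : 0 ≤ yi) (his : yi < s) (hj0 : 0 ≤ yj) (hjs : yj < s)
    (hm : (yi ≤ m ∧ m ≤ yj) ∨ (yj ≤ m ∧ m ≤ yi))
    (h : ∀ y z, (z = i ∧ (yi ≤ y ∧ y ≤ m ∨ m ≤ y ∧ y ≤ yi)) ∨ (y = m ∧ i ≤ z ∧ z ≤ j) ∨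
      (z = j ∧ (m ≤ y ∧ y ≤ yj ∨ yj ≤ y ∧ y ≤ m)) → H y z →
      (y = yi ∧ z = i) ∨ (y = yj ∧ z = j)) :
    (cylinder s t).Visible M (cylinderPoint s t yi i) (cylinderPoint s t yj j) :=
  visible_of_five_segments ht hH m i m le_rfl hij hd hit hjt hi0 his hj0 hjs (by omega)
    fun y z hz => h y z (by omega)

/-- Visibility along a horizontal-vertical-horizontal path. -/
theorem visible_of_column (ht : 2 ≤ t) {M : Set (Fin s × Fin t)}
    {H : ℤ → ℤ → Prop}
    (hH : ∀ y z : ℤ, 0 ≤ y → y < s → -(t : ℤ) < z → z < t → cylinderPoint s t y z ∈ M → H y z)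
    {i j yi yj : ℤ}
    (k : ℤ) (hik : i ≤ k) (hkj : k ≤ j) (hd : 2 * (j - i) ≤ t)
    (hit : -(t : ℤ) < i) (hjt : j < t)
    (hi0 : 0 ≤ yi) (his : yi < s) (hj0 : 0 ≤ yj) (hjs : yj < s)
    (h : ∀ y z, (y = yi ∧ i ≤ z ∧ z ≤ k) ∨ (z = k ∧ (yi ≤ y ∧ y ≤ yj ∨ yj ≤ y ∧ y ≤ yi)) ∨
      (y = yj ∧ k ≤ z ∧ z ≤ j) → H y z →
      (y = yi ∧ z = i) ∨ (y = yj ∧ z = j)) :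
    (cylinder s t).Visible M (cylinderPoint s t yi i) (cylinderPoint s t yj j) :=
  visible_of_five_segments ht hH yi k yj hik hkj hd hit hjt hi0 his hj0 hjs (by omega)
    fun y z hz => h y z (by omega)

end Lift

-- Sets with two members in every column.

section TwoPerColumn

variable {s t : ℕ} [NeZero s] [NeZero t]

/-- The set with members at the heights `A x` and `B x` in each column `x`. -/
def columnPairs (s t : ℕ) (A B : ℤ → ℤ) : Set (Fin s × Fin t) :=
  {p | (p.1 : ℤ) = A p.2 ∨ (p.1 : ℤ) = B p.2}

theorem cylinderPoint_mem_columnPairs {A B : ℤ → ℤ} {y : ℤ} (z : ℤ) (h0 : 0 ≤ y) (hs : y < s) :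
    cylinderPoint s t y z ∈ columnPairs s t A B ↔ y = A (z % t) ∨ y = B (z % t) := by
  simp only [columnPairs, Set.mem_ofPred_eq, cylinderPoint_fst z h0 hs, cylinderPoint_snd]

theorem two_mul_le_ncard_columnPairs {A B : ℤ → ℤ}
    (hA : ∀ x : ℤ, 0 ≤ x → x < t → 0 ≤ A x ∧ A x < s)
    (hB : ∀ x : ℤ, 0 ≤ x → x < t → 0 ≤ B x ∧ B x < s)
    (hAB : ∀ x : ℤ, 0 ≤ x → x < t → A x ≠ B x) :
    2 * t ≤ (columnPairs s t A B).ncard := by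
  let f : Fin t × Bool → Fin s × Fin t := fun q =>
    cylinderPoint s t (if q.2 then A (q.1 : ℤ) else B (q.1 : ℤ)) (q.1 : ℤ)
  have hx : ∀ x : Fin t, (0 : ℤ) ≤ x ∧ (x : ℤ) < t := fun x => ⟨by omega, by omega⟩
  have hlift : ∀ q : Fin t × Bool, 0 ≤ (if q.2 then A (q.1 : ℤ) else B (q.1 : ℤ)) ∧
      (if q.2 then A (q.1 : ℤ) else B (q.1 : ℤ)) < s := by
    intro q
    split_ifs
    exacts [hA _ (hx _).1 (hx _).2, hB _ (hx _).1 (hx _).2]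
  have hfst : ∀ q, ((f q).1 : ℤ) = if q.2 then A (q.1 : ℤ) else B (q.1 : ℤ) := fun q =>
    cylinderPoint_fst _ (hlift q).1 (hlift q).2
  have hsnd : ∀ q, (f q).2 = q.1 := fun q => by
    have : ((f q).2 : ℤ) = q.1 := by
      rw [cylinderPoint_snd, Int.emod_eq_of_lt (hx _).1 (hx _).2]
    exact Fin.ext (by exact_mod_cast this)
  have hinj : Function.Injective f := by
    rintro ⟨x, b⟩ ⟨x', b'⟩ h
    have h2 := hsnd (x, b)
    rw [h, hsnd] at h2
    obtain rfl : x' = x := h2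
    have h1 := hfst (x', b)
    rw [h, hfst] at h1
    have := hAB x' (hx _).1 (hx _).2
    have := this.symm
    cases b <;> cases b' <;> simp_all
  have hsub : f '' Set.univ ⊆ columnPairs s t A B := by
    rintro _ ⟨q, -, rfl⟩
    simp only [columnPairs, Set.mem_ofPred_eq, hfst, hsnd]
    split_ifs <;> simp
  calc 2 * t = (f '' Set.univ).ncard := by
        rw [Set.ncard_image_of_injective _ hinj, Set.ncard_univ]
        simp [mul_comm]
    _ ≤ _ := Set.ncard_le_ncard hsub

theorem isMutualVisibilitySet_columnPairs {A B : ℤ → ℤ}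
    (h : ∀ i j yi yj : ℤ, 0 ≤ i → i ≤ j → j < t → (yi = A i ∨ yi = B i) → (yj = A j ∨ yj = B j) →
      (cylinder s t).Visible (columnPairs s t A B) (cylinderPoint s t yi i)
        (cylinderPoint s t yj j)) :
    (cylinder s t).IsMutualVisibilitySet (columnPairs s t A B) := by
  intro u hu v hv
  rcases le_total (u.2 : ℤ) v.2 with huv | huv
  · have := h u.2 v.2 u.1 v.1 (by omega) huv (by omega) hu hv
    rwa [cylinderPoint_coe, cylinderPoint_coe] at this
  · have := h v.2 u.2 v.1 u.1 (by omega) huv (by omega) hv hu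
    rw [cylinderPoint_coe, cylinderPoint_coe] at this
    exact this.symm

theorem mutualVisibilityNumber_cylinder_eq (ht : 2 ≤ t) {A B : ℤ → ℤ}
    (hA : ∀ x : ℤ, 0 ≤ x → x < t → 0 ≤ A x ∧ A x < s)
    (hB : ∀ x : ℤ, 0 ≤ x → x < t → 0 ≤ B x ∧ B x < s)
    (hAB : ∀ x : ℤ, 0 ≤ x → x < t → A x ≠ B x)
    (h : (cylinder s t).IsMutualVisibilitySet (columnPairs s t A B)) :
    (cylinder s t).mutualVisibilityNumber = 2 * t := by
  have hg := isGreatest_mutualVisibilityNumber (cylinder s t)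
  obtain ⟨M, hM, hc⟩ := hg.1
  exact le_antisymm (hc ▸ hM.ncard_le_cylinder ht)
    ((two_mul_le_ncard_columnPairs hA hB hAB).trans (hg.2 ⟨_, h, rfl⟩))

end TwoPerColumn

-- The two tents, for at least seven columns.

section Tent

/-- The lower heights: a tent around the column `0`, which itself has height `0`. -/
def lowerTent (n x : ℤ) : ℤ := if x = 0 then 0 else if x ≤ n then n - x else x - n - 1

/-- The upper heights: the image of the lower heights under the half-turn. -/
def upperTent (t n x : ℤ) : ℤ :=
  if x = 0 then t - 2 else if x + n < t then n - 1 + x else 2 * t - 2 - n - x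

/-- The point at height `y` and column `z`, with `-t < z < t`, belongs to the two tents. -/
def TentHit (t n y z : ℤ) : Prop :=
  (z = 0 ∧ (y = 0 ∨ y = t - 2)) ∨
  (0 < z ∧ (z ≤ n ∧ y = n - z ∨ n < z ∧ y = z - n - 1 ∨
    z + n < t ∧ y = n - 1 + z ∨ t ≤ z + n ∧ y = 2 * t - 2 - n - z)) ∨
  (z < 0 ∧ (z + t ≤ n ∧ y = n - z - t ∨ n < z + t ∧ y = z + t - n - 1 ∨
    z + n < 0 ∧ y = n - 1 + z + t ∨ 0 ≤ z + n ∧ y = t - 2 - n - z))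

variable {s t : ℕ} [NeZero s] [NeZero t] {n : ℤ}

/-- Membership becomes a linear condition with no remainder, on a window of two periods that
contains both the direct routes and those crossing column `0`. -/
theorem tentHit_of_mem (y z : ℤ) (h0 : 0 ≤ y) (hs : y < s) (hzt : -(t : ℤ) < z) (hz : z < t)
    (h : cylinderPoint s t y z ∈ columnPairs s t (lowerTent n) (upperTent t n)) :
    TentHit t n y z := by
  rw [cylinderPoint_mem_columnPairs z h0 hs] at h
  rcases le_or_gt 0 z with h1 | h1
  · rw [Int.emod_eq_of_lt h1 hz] at h
    rcases h with h | h
    · unfold lowerTent at h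
      unfold TentHit
      split_ifs at h <;> omega
    · unfold upperTent at h
      unfold TentHit
      split_ifs at h <;> omega
  · rw [← Int.add_emod_right, Int.emod_eq_of_lt (by omega) (by omega)] at h
    rcases h with h | h
    · unfold lowerTent at h
      unfold TentHit
      split_ifs at h <;> omega
    · unfold upperTent at h
      unfold TentHit
      split_ifs at h <;> omega

/-- On a single flank the row of the lower endpoint runs beneath the tent. On opposite flanks the
path crosses the valley, between the tents, or passes column `0` beneath the lower tent, whichever
way round is short. -/
theorem visible_lower_lower (ht : 7 ≤ t) (hst : t ≤ s + 1) (hn : 2 * n ≤ t)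
    (hn' : (t : ℤ) ≤ 2 * n + 1)
    {i j yi yj : ℤ} (hi : 0 ≤ i) (hij : i < j) (hj : j < t)
    (hyi : yi = lowerTent n i) (hyj : yj = lowerTent n j) :
    (cylinder s t).Visible (columnPairs s t (lowerTent n) (upperTent t n))
      (cylinderPoint s t yi i) (cylinderPoint s t yj j) := by
  have ht2 : 2 ≤ t := by omega
  have hpar : (t : ℤ) = 2 * n ∨ (t : ℤ) = 2 * n + 1 := by omega
  -- Replacing `j` by `j - t` turns the way round across column `0` into a monotone path from `j -
  -- t` to `i`.
  have hj' : cylinderPoint s t yj j = cylinderPoint s t yj (j - t) := by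
    rw [← cylinderPoint_add yj (j - t), sub_add_cancel]
  have hi' : (i = 0 ∧ yi = 0) ∨ (0 < i ∧ i ≤ n ∧ yi = n - i) ∨ (n < i ∧ yi = i - n - 1) := by
    unfold lowerTent at hyi; split_ifs at hyi <;> omega
  have hJ : (j = 0 ∧ yj = 0) ∨ (0 < j ∧ j ≤ n ∧ yj = n - j) ∨ (n < j ∧ yj = j - n - 1) := by
    unfold lowerTent at hyj; split_ifs at hyj <;> omega
  clear hyi hyj
  by_cases h1 : j ≤ n ∨ n < i
  · refine visible_of_row ht2 tentHit_of_mem (min yi yj)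
      (by omega) (by omega) (by omega) (by omega) (by omega) (by omega) (by omega) (by omega)
      (by omega)
      fun y z hz hh => ?_
    unfold TentHit at hh
    rcases hpar with hpar | hpar <;> rcases hz with hz | hz | hz <;> omega
  · by_cases h2 : 0 < i ∧ 2 * (j - i) ≤ t
    · refine visible_of_row ht2 tentHit_of_mem (max yi yj)
        (by omega) (by omega) (by omega) (by omega) (by omega) (by omega) (by omega) (by omega)
        (by omega)
        fun y z hz hh => ?_
      unfold TentHit at hh
      rcases hpar with hpar | hpar <;> rcases hz with hz | hz | hz <;> omega
    · rw [hj']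
      refine Visible.symm (visible_of_row ht2 tentHit_of_mem (min yi yj)
        (by omega) (by omega) (by omega) (by omega) (by omega) (by omega) (by omega) (by omega)
        (by omega)
        fun y z hz hh => ?_)
      unfold TentHit at hh
      rcases hpar with hpar | hpar <;> rcases hz with hz | hz | hz <;> omega

/-- The half-turn `(y, z) ↦ (t - 2 - y, t - z)` exchanges the tents, so the routes are those for two
lower members with `min` and `max` swapped. -/
theorem visible_upper_upper (ht : 7 ≤ t) (hst : t ≤ s + 1) (hn : 2 * n ≤ t)
    (hn' : (t : ℤ) ≤ 2 * n + 1)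
    {i j yi yj : ℤ} (hi : 0 ≤ i) (hij : i < j) (hj : j < t)
    (hyi : yi = upperTent t n i) (hyj : yj = upperTent t n j) :
    (cylinder s t).Visible (columnPairs s t (lowerTent n) (upperTent t n))
      (cylinderPoint s t yi i) (cylinderPoint s t yj j) := by
  have ht2 : 2 ≤ t := by omega
  have hpar : (t : ℤ) = 2 * n ∨ (t : ℤ) = 2 * n + 1 := by omega
  have hj' : cylinderPoint s t yj j = cylinderPoint s t yj (j - t) := by
    rw [← cylinderPoint_add yj (j - t), sub_add_cancel]
  have hi' : (i = 0 ∧ yi = t - 2) ∨ (0 < i ∧ i + n < t ∧ yi = n - 1 + i) ∨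
      (t ≤ i + n ∧ yi = 2 * t - 2 - n - i) := by
    unfold upperTent at hyi; split_ifs at hyi <;> omega
  have hJ : (j = 0 ∧ yj = t - 2) ∨ (0 < j ∧ j + n < t ∧ yj = n - 1 + j) ∨
      (t ≤ j + n ∧ yj = 2 * t - 2 - n - j) := by
    unfold upperTent at hyj; split_ifs at hyj <;> omega
  clear hyi hyj
  by_cases h1 : j + n < t ∨ t ≤ i + n
  · refine visible_of_row ht2 tentHit_of_mem (max yi yj)
      (by omega) (by omega) (by omega) (by omega) (by omega) (by omega) (by omega) (by omega)
      (by omega)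
      fun y z hz hh => ?_
    unfold TentHit at hh
    rcases hpar with hpar | hpar <;> rcases hz with hz | hz | hz <;> omega
  · by_cases h2 : 0 < i ∧ 2 * (j - i) ≤ t
    · refine visible_of_row ht2 tentHit_of_mem (min yi yj)
        (by omega) (by omega) (by omega) (by omega) (by omega) (by omega) (by omega) (by omega)
        (by omega)
        fun y z hz hh => ?_
      unfold TentHit at hh
      rcases hpar with hpar | hpar <;> rcases hz with hz | hz | hz <;> omega
    · rw [hj']
      refine Visible.symm (visible_of_row ht2 tentHit_of_mem (max yi yj)
        (by omega) (by omega) (by omega) (by omega) (by omega) (by omega) (by omega) (by omega)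
        (by omega)
        fun y z hz hh => ?_)
      unfold TentHit at hh
      rcases hpar with hpar | hpar <;> rcases hz with hz | hz | hz <;> omega

theorem visible_lower_upper (ht : 7 ≤ t) (hst : t ≤ s + 1) (hn : 2 * n ≤ t)
    (hn' : (t : ℤ) ≤ 2 * n + 1)
    {i j yi yj : ℤ} (hi : 0 ≤ i) (hij : i < j) (hj : j < t)
    (hyi : yi = lowerTent n i) (hyj : yj = upperTent t n j) :
    (cylinder s t).Visible (columnPairs s t (lowerTent n) (upperTent t n))
      (cylinderPoint s t yi i) (cylinderPoint s t yj j) := by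
  have ht2 : 2 ≤ t := by omega
  have hpar : (t : ℤ) = 2 * n ∨ (t : ℤ) = 2 * n + 1 := by omega
  have hj' : cylinderPoint s t yj j = cylinderPoint s t yj (j - t) := by
    rw [← cylinderPoint_add yj (j - t), sub_add_cancel]
  have hi' : (i = 0 ∧ yi = 0) ∨ (0 < i ∧ i ≤ n ∧ yi = n - i) ∨ (n < i ∧ yi = i - n - 1) := by
    unfold lowerTent at hyi; split_ifs at hyi <;> omega
  have hJ : (j = 0 ∧ yj = t - 2) ∨ (0 < j ∧ j + n < t ∧ yj = n - 1 + j) ∨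
      (t ≤ j + n ∧ yj = 2 * t - 2 - n - j) := by
    unfold upperTent at hyj; split_ifs at hyj <;> omega
  clear hyi hyj
  by_cases h0 : i = 0
  · by_cases h1 : yj = t - 2
    -- From `(0, 0)` to the peak of the upper tent: the corridor in column `0` is closed at height
    -- `t - 2` by a member. The path leaves it at `t - 3`, climbs in the neighbouring column and
    -- finishes along row `t - 2`.
    · by_cases h2 : 2 * j < t
      · refine visible_of_five_segments ht2 tentHit_of_mem (t - 3) 1 (t - 2)
          (by omega) (by omega) (by omega) (by omega) (by omega) (by omega) (by omega) (by omega)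
          (by omega) (by omega)
          fun y z hz hh => ?_
        unfold TentHit at hh
        rcases hpar with hpar | hpar <;> rcases hz with hz | hz | hz | hz | hz <;> omega
      · rw [hj']
        refine Visible.symm (visible_of_five_segments ht2 tentHit_of_mem (t - 2) (-1) (t - 3)
          (by omega) (by omega) (by omega) (by omega) (by omega) (by omega) (by omega) (by omega)
          (by omega) (by omega)
          fun y z hz hh => ?_)
        unfold TentHit at hh
        rcases hpar with hpar | hpar <;> rcases hz with hz | hz | hz | hz | hz <;> omega
    · by_cases h2 : 2 * j ≤ t
      · refine visible_of_column ht2 tentHit_of_mem 0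
          (by omega) (by omega) (by omega) (by omega) (by omega) (by omega) (by omega) (by omega)
          (by omega)
          fun y z hz hh => ?_
        unfold TentHit at hh
        rcases hpar with hpar | hpar <;> rcases hz with hz | hz | hz <;> omega
      · rw [hj']
        refine Visible.symm (visible_of_column ht2 tentHit_of_mem 0
          (by omega) (by omega) (by omega) (by omega) (by omega) (by omega) (by omega) (by omega)
          (by omega)
          fun y z hz hh => ?_)
        unfold TentHit at hh
        rcases hpar with hpar | hpar <;> rcases hz with hz | hz | hz <;> omega
  -- Row `n - 1` lies strictly between the tents on columns `2, …, t - 2`. In column `t - 1` the two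
  -- members have adjacent heights, so a target there has to be approached along its own row.
  · by_cases h1 : 2 * (j - i) < t
    · by_cases h3 : j = t - 1
      · refine visible_of_row ht2 tentHit_of_mem (yj)
          (by omega) (by omega) (by omega) (by omega) (by omega) (by omega) (by omega) (by omega)
          (by omega)
          fun y z hz hh => ?_
        unfold TentHit at hh
        rcases hpar with hpar | hpar <;> rcases hz with hz | hz | hz <;> omega
      · refine visible_of_row ht2 tentHit_of_mem (n - 1)
          (by omega) (by omega) (by omega) (by omega) (by omega) (by omega) (by omega) (by omega)
          (by omega)
          fun y z hz hh => ?_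
        unfold TentHit at hh
        rcases hpar with hpar | hpar <;> rcases hz with hz | hz | hz <;> omega
    · rw [hj']
      refine Visible.symm (visible_of_column ht2 tentHit_of_mem 0
        (by omega) (by omega) (by omega) (by omega) (by omega) (by omega) (by omega) (by omega)
        (by omega)
        fun y z hz hh => ?_)
      unfold TentHit at hh
      rcases hpar with hpar | hpar <;> rcases hz with hz | hz | hz <;> omega

theorem visible_upper_lower (ht : 7 ≤ t) (hst : t ≤ s + 1) (hn : 2 * n ≤ t)
    (hn' : (t : ℤ) ≤ 2 * n + 1)
    {i j yi yj : ℤ} (hi : 0 ≤ i) (hij : i < j) (hj : j < t)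
    (hyi : yi = upperTent t n i) (hyj : yj = lowerTent n j) :
    (cylinder s t).Visible (columnPairs s t (lowerTent n) (upperTent t n))
      (cylinderPoint s t yi i) (cylinderPoint s t yj j) := by
  have ht2 : 2 ≤ t := by omega
  have hpar : (t : ℤ) = 2 * n ∨ (t : ℤ) = 2 * n + 1 := by omega
  have hj' : cylinderPoint s t yj j = cylinderPoint s t yj (j - t) := by
    rw [← cylinderPoint_add yj (j - t), sub_add_cancel]
  have hi' : (i = 0 ∧ yi = t - 2) ∨ (0 < i ∧ i + n < t ∧ yi = n - 1 + i) ∨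
      (t ≤ i + n ∧ yi = 2 * t - 2 - n - i) := by
    unfold upperTent at hyi; split_ifs at hyi <;> omega
  have hJ : (j = 0 ∧ yj = 0) ∨ (0 < j ∧ j ≤ n ∧ yj = n - j) ∨ (n < j ∧ yj = j - n - 1) := by
    unfold lowerTent at hyj; split_ifs at hyj <;> omega
  clear hyi hyj
  by_cases h0 : i = 0
  · by_cases h1 : yj = 0
    -- The half-turned detour: leave column `0` at height `1`, just above its member at height `0`,
    -- and descend in the neighbouring column.
    · by_cases h2 : 2 * j ≤ t
      · refine visible_of_five_segments ht2 tentHit_of_mem 1 1 0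
          (by omega) (by omega) (by omega) (by omega) (by omega) (by omega) (by omega) (by omega)
          (by omega) (by omega)
          fun y z hz hh => ?_
        unfold TentHit at hh
        rcases hpar with hpar | hpar <;> rcases hz with hz | hz | hz | hz | hz <;> omega
      · rw [hj']
        refine Visible.symm (visible_of_five_segments ht2 tentHit_of_mem 0 (-1) 1
          (by omega) (by omega) (by omega) (by omega) (by omega) (by omega) (by omega) (by omega)
          (by omega) (by omega)
          fun y z hz hh => ?_)
        unfold TentHit at hh
        rcases hpar with hpar | hpar <;> rcases hz with hz | hz | hz | hz | hz <;> omega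
    · by_cases h2 : 2 * j ≤ t
      · refine visible_of_column ht2 tentHit_of_mem 0
          (by omega) (by omega) (by omega) (by omega) (by omega) (by omega) (by omega) (by omega)
          (by omega)
          fun y z hz hh => ?_
        unfold TentHit at hh
        rcases hpar with hpar | hpar <;> rcases hz with hz | hz | hz <;> omega
      · rw [hj']
        refine Visible.symm (visible_of_column ht2 tentHit_of_mem 0
          (by omega) (by omega) (by omega) (by omega) (by omega) (by omega) (by omega) (by omega)
          (by omega)
          fun y z hz hh => ?_)
        unfold TentHit at hh
        rcases hpar with hpar | hpar <;> rcases hz with hz | hz | hz <;> omega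
  -- The route through column `0` turns there at heights `yj` and `yi`, so it hits a member if `yj =
  -- 0` or `yi = t - 2`. For opposite columns these cases take the direct route.
  · by_cases h1 : 2 * (j - i) < t ∨ 2 * (j - i) = t ∧ (yj = 0 ∨ yi = t - 2)
    -- Here the start has height `n` and the lower member sits right below it, so row `n` replaces
    -- row `n - 1`. This uses `7 ≤ t`: for `t = 6` and `j = 4` the turning point `(n, j)` would be
    -- an upper member.
    · by_cases h2 : i = 1
      · refine visible_of_row ht2 tentHit_of_mem (n)
          (by omega) (by omega) (by omega) (by omega) (by omega) (by omega) (by omega) (by omega)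
          (by omega)
          fun y z hz hh => ?_
        unfold TentHit at hh
        rcases hpar with hpar | hpar <;> rcases hz with hz | hz | hz <;> omega
      · by_cases h3 : j = t - 1
        · refine visible_of_row ht2 tentHit_of_mem (yj)
            (by omega) (by omega) (by omega) (by omega) (by omega) (by omega) (by omega) (by omega)
            (by omega)
            fun y z hz hh => ?_
          unfold TentHit at hh
          rcases hpar with hpar | hpar <;> rcases hz with hz | hz | hz <;> omega
        · refine visible_of_row ht2 tentHit_of_mem (n - 1)
            (by omega) (by omega) (by omega) (by omega) (by omega) (by omega) (by omega) (by omega)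
            (by omega)
            fun y z hz hh => ?_
          unfold TentHit at hh
          rcases hpar with hpar | hpar <;> rcases hz with hz | hz | hz <;> omega
    · rw [hj']
      refine Visible.symm (visible_of_column ht2 tentHit_of_mem 0
        (by omega) (by omega) (by omega) (by omega) (by omega) (by omega) (by omega) (by omega)
        (by omega)
        fun y z hz hh => ?_)
      unfold TentHit at hh
      rcases hpar with hpar | hpar <;> rcases hz with hz | hz | hz <;> omega

end Tent

-- Two members of the same column.

section SameColumn

variable {s t : ℕ} [NeZero s] [NeZero t]

theorem visible_same_column (ht : 2 ≤ t) {A B : ℤ → ℤ} {i yi yj : ℤ} (hi : 0 ≤ i) (hit : i < t)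
    (hA : 0 ≤ A i ∧ A i < s) (hB : 0 ≤ B i ∧ B i < s) (hyi : yi = A i ∨ yi = B i)
    (hyj : yj = A i ∨ yj = B i) :
    (cylinder s t).Visible (columnPairs s t A B) (cylinderPoint s t yi i)
      (cylinderPoint s t yj i) := by
  by_cases hij : yi = yj
  · subst hij
    -- The path is a single point, its own endpoint, so nothing need be known about the set.
    refine visible_of_row ht (H := fun _ _ => True) (fun _ _ _ _ _ _ _ => trivial) yi
      le_rfl (by omega) (by omega) hit (by omega) (by omega) (by omega) (by omega) (by omega)
      fun y z hz _ => by omega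
  · refine visible_of_row ht (H := fun y z => y = A (z % t) ∨ y = B (z % t))
      (fun y z h0 hs _ _ => (cylinderPoint_mem_columnPairs z h0 hs).1) yj
      le_rfl (by omega) (by omega) hit (by omega) (by omega) (by omega) (by omega) (by omega)
      fun y z hz hy => ?_
    obtain rfl : z = i := by omega
    rw [Int.emod_eq_of_lt hi hit] at hy
    omega

end SameColumn

theorem mutualVisibilityNumber_cylinder_of_seven_le {s t : ℕ} (ht : 7 ≤ t) (hst : t ≤ s + 1) :
    (cylinder s t).mutualVisibilityNumber = 2 * t := by
  have : NeZero s := ⟨by omega⟩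
  have : NeZero t := ⟨by omega⟩
  obtain ⟨n, hn, hn'⟩ : ∃ n : ℤ, 2 * n ≤ t ∧ (t : ℤ) ≤ 2 * n + 1 := ⟨t / 2, by omega, by omega⟩
  have hA : ∀ x : ℤ, 0 ≤ x → x < t → 0 ≤ lowerTent n x ∧ lowerTent n x < s := by
    intro x h0 h1
    unfold lowerTent
    split_ifs <;> omega
  have hB : ∀ x : ℤ, 0 ≤ x → x < t → 0 ≤ upperTent t n x ∧ upperTent t n x < s := by
    intro x h0 h1
    unfold upperTent
    split_ifs <;> omega
  refine mutualVisibilityNumber_cylinder_eq (by omega) hA hB ?_ ?_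
  · intro x h0 h1
    unfold lowerTent upperTent
    split_ifs <;> omega
  · refine isMutualVisibilitySet_columnPairs fun i j yi yj hi hij hj hyi hyj => ?_
    rcases hij.eq_or_lt with rfl | hij
    · exact visible_same_column (by omega) hi hj (hA i hi hj) (hB i hi hj) hyi hyj
    · rcases hyi with hyi | hyi <;> rcases hyj with hyj | hyj
      · exact visible_lower_lower ht hst hn hn' hi hij hj hyi hyj
      · exact visible_lower_upper ht hst hn hn' hi hij hj hyi hyj
      · exact visible_upper_lower ht hst hn hn' hi hij hj hyi hyj
      · exact visible_upper_upper ht hst hn hn' hi hij hj hyi hyj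

-- The case of six columns.

section SixColumns

/-- The lower heights of a mutual-visibility set on six columns. -/
def lowerSix (x : ℤ) : ℤ := if x = 1 ∨ x = 3 then 1 else if x = 5 then 2 else 0

/-- The upper heights of a mutual-visibility set on six columns. -/
def upperSix (x : ℤ) : ℤ := if x = 1 then 2 else if x = 3 ∨ x = 5 then 3 else 4

/-- Membership in the set with heights `lowerSix` and `upperSix`, on natural coordinates. -/
def sixHit (y z : ℕ) : Bool :=
  match z % 6 with
  | 1 => y == 1 || y == 2
  | 3 => y == 1 || y == 3
  | 5 => y == 2 || y == 3
  | _ => y == 0 || y == 4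

/-- Some vertical-horizontal-vertical path from `(yi, i)` to `(yj, j)` avoids the set. -/
def SixRow (i j yi yj : ℕ) : Prop :=
  ∃ m < 5, ((yi ≤ m ∧ m ≤ yj) ∨ (yj ≤ m ∧ m ≤ yi)) ∧ ∀ y < 5, ∀ z < 12,
    (z = i ∧ (yi ≤ y ∧ y ≤ m ∨ m ≤ y ∧ y ≤ yi)) ∨ (y = m ∧ i ≤ z ∧ z ≤ j) ∨
      (z = j ∧ (m ≤ y ∧ y ≤ yj ∨ yj ≤ y ∧ y ≤ m)) → sixHit y z = true →
      (y = yi ∧ z = i) ∨ (y = yj ∧ z = j)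

/-- Some horizontal-vertical-horizontal path from `(yi, i)` to `(yj, j)` avoids the set. -/
def SixColumn (i j yi yj : ℕ) : Prop :=
  ∃ k < 12, i ≤ k ∧ k ≤ j ∧ ∀ y < 5, ∀ z < 12,
    (y = yi ∧ i ≤ z ∧ z ≤ k) ∨ (z = k ∧ (yi ≤ y ∧ y ≤ yj ∨ yj ≤ y ∧ y ≤ yi)) ∨
      (y = yj ∧ k ≤ z ∧ z ≤ j) → sixHit y z = true →
      (y = yi ∧ z = i) ∨ (y = yj ∧ z = j)

set_option synthInstance.maxSize 2000 in
set_option synthInstance.maxHeartbeats 400000 in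
instance (i j yi yj : ℕ) : Decidable (SixRow i j yi yj) := by
  unfold SixRow; infer_instance

set_option synthInstance.maxSize 2000 in
set_option synthInstance.maxHeartbeats 400000 in
instance (i j yi yj : ℕ) : Decidable (SixColumn i j yi yj) := by
  unfold SixColumn; infer_instance

set_option synthInstance.maxSize 2000 in
set_option synthInstance.maxHeartbeats 400000 in
-- A finite check. Columns are unrolled to `0, …, 11` so that the way round from `j` to `i + 6` is
-- again monotone; two turns always suffice.
theorem six_row_or_column : ∀ i < 6, ∀ j < 6, i < j → ∀ yi < 5, sixHit yi i = true →
    ∀ yj < 5, sixHit yj j = true →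
    (2 * (j - i) ≤ 6 ∧ (SixRow i j yi yj ∨ SixColumn i j yi yj)) ∨
    (6 ≤ 2 * (j - i) ∧ (SixRow j (i + 6) yj yi ∨ SixColumn j (i + 6) yj yi)) := by
  decide +kernel

theorem sixHit_iff {y z : ℕ} : sixHit y z = true ↔
    (y : ℤ) = lowerSix ((z : ℤ) % 6) ∨ (y : ℤ) = upperSix ((z : ℤ) % 6) := by
  have h6 : (z : ℤ) % 6 = (z % 6 : ℕ) := by omega
  rw [h6]
  have := Nat.mod_lt z (show 6 > 0 by omega)
  unfold sixHit
  generalize z % 6 = r at *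
  unfold lowerSix upperSix
  interval_cases r <;> simp <;> omega

variable {s : ℕ} [NeZero s]

theorem sixHit_of_mem (a : ℕ) (ha : a % 6 = 0) (y z : ℤ) (h0 : 0 ≤ y) (hs : y < s)
    (hz : 0 ≤ z + a)
    (h : cylinderPoint s 6 y z ∈ columnPairs s 6 lowerSix upperSix) :
    sixHit y.toNat (z + a).toNat = true := by
  rw [cylinderPoint_mem_columnPairs z h0 hs] at h
  rw [sixHit_iff, Int.toNat_of_nonneg h0, Int.toNat_of_nonneg hz]
  rwa [show (z + a) % 6 = z % ((6 : ℕ) : ℤ) by omega]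

/-- The shift `a` translates the unrolled natural columns back into the window `(-6, 6)`: `a = 0`
for direct routes, `a = 6` for those crossing column `0`. -/
theorem visible_of_sixRow_or_sixColumn (hs : 5 ≤ s) {i j yi yj a : ℕ} (ha : a = 0 ∨ a = 6)
    (hai : a ≤ i + 5) (hij : i < j) (hd : 2 * (j - i) ≤ 6) (hja : j < a + 6) (hj : j < 12)
    (hi5 : yi < 5) (hj5 : yj < 5) (h : SixRow i j yi yj ∨ SixColumn i j yi yj) :
    (cylinder s 6).Visible (columnPairs s 6 lowerSix upperSix)
      (cylinderPoint s 6 yi (i - a)) (cylinderPoint s 6 yj (j - a)) := by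
  have hH : ∀ y z : ℤ, 0 ≤ y → y < s → -((6 : ℕ) : ℤ) < z → z < (6 : ℕ) →
      cylinderPoint s 6 y z ∈ columnPairs s 6 lowerSix upperSix →
      -- The guard is needed since `toNat` sends negative columns to `0`; every column on the path
      -- satisfies it.
      (0 ≤ z + a → sixHit y.toNat (z + a).toNat = true) := fun y z h0 h1 _ _ hm h2 =>
    sixHit_of_mem a (by omega) y z h0 h1 h2 hm
  rcases h with ⟨m, hm5, hm, h⟩ | ⟨k, hk12, hik, hkj, h⟩
  · refine visible_of_row (by omega) hH m (by omega) (by omega) (by omega) (by omega) (by omega)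
      (by omega) (by omega) (by omega) (by omega) fun y z hz hy => ?_
    have := h y.toNat (by omega) (z + a).toNat (by omega) (by omega) (hy (by omega))
    omega
  · refine visible_of_column (by omega) hH (k - a) (by omega) (by omega) (by omega) (by omega)
      (by omega) (by omega) (by omega) (by omega) (by omega) fun y z hz hy => ?_
    have := h y.toNat (by omega) (z + a).toNat (by omega) (by omega) (hy (by omega))
    omega

theorem mutualVisibilityNumber_cylinder_six (hs : 5 ≤ s) :
    (cylinder s 6).mutualVisibilityNumber = 2 * 6 := by
  have hA : ∀ x : ℤ, 0 ≤ lowerSix x ∧ lowerSix x < 5 := by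
    intro x
    unfold lowerSix
    split_ifs <;> omega
  have hB : ∀ x : ℤ, 0 ≤ upperSix x ∧ upperSix x < 5 := by
    intro x
    unfold upperSix
    split_ifs <;> omega
  have hA' : ∀ x : ℤ, 0 ≤ lowerSix x ∧ lowerSix x < s :=
    fun x => ⟨(hA x).1, by have := hA x; omega⟩
  have hB' : ∀ x : ℤ, 0 ≤ upperSix x ∧ upperSix x < s :=
    fun x => ⟨(hB x).1, by have := hB x; omega⟩
  refine mutualVisibilityNumber_cylinder_eq (by omega) (fun x _ _ => hA' x) (fun x _ _ => hB' x)
    ?_ ?_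
  · intro x h0 h1
    unfold lowerSix upperSix
    split_ifs <;> omega
  · refine isMutualVisibilitySet_columnPairs fun i j yi yj hi hij hj hyi hyj => ?_
    rcases hij.eq_or_lt with rfl | hij
    · exact visible_same_column (by omega) hi hj (hA' i) (hB' i) hyi hyj
    · have hyi0 : 0 ≤ yi ∧ yi < 5 := by
        rcases hyi with rfl | rfl
        exacts [hA i, hB i]
      have hyj0 : 0 ≤ yj ∧ yj < 5 := by
        rcases hyj with rfl | rfl
        exacts [hA j, hB j]
      lift i to ℕ using hi
      lift j to ℕ using by omega
      lift yi to ℕ using hyi0.1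
      lift yj to ℕ using hyj0.1
      rw [← Int.emod_eq_of_lt (a := i) (b := 6) (by omega) (by omega), ← sixHit_iff] at hyi
      rw [← Int.emod_eq_of_lt (a := j) (b := 6) (by omega) (by omega), ← sixHit_iff] at hyj
      rcases six_row_or_column i (by omega) j (by omega) (by omega) yi (by omega) hyi yj (by omega)
        hyj with ⟨hd, h⟩ | ⟨hd, h⟩
      · simpa using visible_of_sixRow_or_sixColumn hs (a := 0) (by omega) (by omega) (by omega) hd
          (by omega) (by omega) (by omega) (by omega) h
      · have := visible_of_sixRow_or_sixColumn hs (a := 6) (by omega) (by omega) (by omega)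
          (by omega) (by omega) (by omega) (by omega) (by omega) h
        rw [← cylinderPoint_add _ ((j : ℤ) - (6 : ℕ)), sub_add_cancel] at this
        simpa using this.symm

end SixColumns

end SimpleGraph

theorem theorem1 (s t : ℕ) (ht : 6 ≤ t) (hst : t ≤ s + 1) :
    (SimpleGraph.boxProd (SimpleGraph.pathGraph s) (SimpleGraph.cycleGraph t)).mutualVisibilityNumber
      = 2 * t := by
  rcases ht.eq_or_lt with rfl | ht
  · have : NeZero s := ⟨by omega⟩
    exact SimpleGraph.mutualVisibilityNumber_cylinder_six (by omega)
  · exact SimpleGraph.mutualVisibilityNumber_cylinder_of_seven_le ht hst
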